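/- Let $\alpha\in(0,1)$ be irrational with continued fraction $\alpha=[0;a_1,a_2,\dots]$, and let $q_0=1$, $q_1=a_1$, $q_{k+1}=a_{k+1}q_k+q_{k-1}$ $(k\ge 1)$ be the denominators of its convergents. The Ostrowski representation of a positive integer $x$ with respect to $\alpha$ is the unique representation $x=\sum_{k\ge 0} b_kq_k$ with integer digits $b_k$, only finitely many of them nonzero, such that $0\le b_0\le a_1-1$, $0\le b_k\le a_{k+1}$ for $k\ge 1$, and $b_{k-1}=0$ whenever $k\ge 1$ and $b_k=a_{k+1}$. For $\theta\in[0,1)$ let $s_i=\lfloor (i+1)\alpha+\theta\rfloor-\lfloor i\alpha+\theta\rfloor$ $(i\ge 1)$ be the Sturmian word of slope $\alpha$ and intercept $\theta$. For integers $m,n\ge 1$, its $m\times n$ (Hankel) rectangles are called balanced if there is an integer $c$ such that $\sum_{k=0}^{m-1}\sum_{\ell=0}^{n-1}s_{i+k+\ell}\in\{c,c+1\}$ for all $i\ge 1$. Theorem. Let $\alpha\in(0,1)$ be irrational, $\theta\in[0,1)$, and let $2\le m\le n$ be integers. Let $m=\sum_k b_kq_k$ and $n=\sum_k d_kq_k$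 be the Ostrowski representations of $m$ and $n$ with respect to $\alpha$. Then the $m\times n$ rectangles of the Sturmian word of slope $\alpha$ and intercept $\theta$ are balanced if and only if at least one of the following holds: (i) there is $M\ge 0$ such that $b_k=0$ for all $k>M$ and $d_k=0$ for all $k\le M$, i.e. $m=\sum_{k=0}^{M}b_kq_k$ and $n=\sum_{k\ge M+1}d_kq_k$; (ii) there are $M,t\ge 0$ such that $m=\sum_{k=0}^{M}b_kq_k$ with $b_M\ne 0$, and $n=q_M+\sum_{k\ge M+1+2t}d_kq_k$ with $d_{M+1+2t}\neq 0$ (that is, $d_M=1$ and all other $d_k$ with $k<M+1+2t$ vanish); (iii) there are $M,t\ge 0$ such that $m=q_M$ and $n=\sum_{k=0}^{M-1}d_kq_k+\sum_{k\ge M+2t}d_kq_k$ with $d_{M+2t}\ne 0$; (iv) there are $M\ge 1$, $t\ge 0$ and $1\le a<a_{M+1}$ such that $m=q_{M-1}+aq_M$ and $n=\sum_{k=0}^{M-1}d_kq_k+\sum_{k\ge M+1+2t}d_kq_k$ with $d_{M+1+2t}\ne 0$. -/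

import Mathlib

/-- The partial quotients `a₀, a₁, a₂, …` of the simple continued fraction
`α = [a₀; a₁, a₂, …]` of a positive irrational number `α`, as natural numbers, read off from
Mathlib's continued fraction `GenContFract.of α` (whose sequence of partial denominators starts
with `a₁` at position `0`). -/
noncomputable def partQuot (α : ℝ) : ℕ → ℕ
  | 0 => ⌊α⌋₊
  | k + 1 => ⌊((GenContFract.of α).partDens.get? k).getD 0⌋₊

/-- The denominators `q₀, q₁, q₂, …` of the convergents of `α`. -/
noncomputable def convDen (α : ℝ) : ℕ → ℕ
  | 0 => 1
  | 1 => partQuot α 1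
  | k + 2 => partQuot α (k + 2) * convDen α (k + 1) + convDen α k

/-- For irrational `α`, `partQuot α (k + 1)` is the `k`-th entry of Mathlib's sequence of partial
denominators: no truncation takes place. -/
theorem partDens_get?_eq {α : ℝ} (hα : Irrational α) (k : ℕ) :
    (GenContFract.of α).partDens.get? k = some (partQuot α (k + 1) : ℝ) := by
  have hnt : ¬ (GenContFract.of α).TerminatedAt k := by
    intro h
    obtain ⟨r, hr⟩ := GenContFract.exists_rat_eq_of_terminates (v := α) ⟨k, h⟩
    exact hα ⟨r, hr.symm⟩
  have hne : (GenContFract.of α).partDens.get? k ≠ none := by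
    intro h
    exact hnt (GenContFract.terminatedAt_iff_partDen_none.2 h)
  obtain ⟨b, hb⟩ := Option.ne_none_iff_exists'.1 hne
  obtain ⟨z, hz⟩ := GenContFract.exists_int_eq_of_partDen hb
  have h1 : 1 ≤ b := GenContFract.of_one_le_get?_partDen hb
  have hz0 : 0 ≤ z := by
    have : (0 : ℝ) ≤ z := by rw [← hz]; linarith
    exact_mod_cast this
  obtain ⟨n, rfl⟩ := Int.eq_ofNat_of_zero_le hz0
  have hbn : b = (n : ℝ) := by simpa using hz
  subst hbn
  simp [partQuot, hb]

/-- For irrational `α`, `convDen α k` is Mathlib's denominator of the `k`-th convergent. -/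
theorem convDen_cast {α : ℝ} (hα : Irrational α) (k : ℕ) :
    (convDen α k : ℝ) = (GenContFract.of α).dens k := by
  have hs : ∀ k, (GenContFract.of α).s.get? k = some ⟨1, (partQuot α (k + 1) : ℝ)⟩ := by
    intro k
    obtain ⟨gp, hgp, hb⟩ := GenContFract.exists_s_b_of_partDen (partDens_get?_eq hα k)
    have ha := GenContFract.of_partNum_eq_one (GenContFract.partNum_eq_s_a hgp)
    rw [hgp, ← ha, ← hb]
  induction k using Nat.twoStepInduction with
  | zero => simp [convDen, GenContFract.zeroth_den_eq_one]
  | one => rw [GenContFract.first_den_eq (hs 0)]; simp [convDen]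
  | more k h0 h1 =>
    rw [GenContFract.dens_recurrence (hs (k + 1)) rfl rfl, ← h0, ← h1]
    simp [convDen]

/-- `IsOstrowski α b n`: the digits `b₀, b₁, …` (finitely many of them nonzero) form the Ostrowski
representation `n = ∑ₖ bₖ qₖ` of `n` with respect to `α`. -/
structure IsOstrowski (α : ℝ) (b : ℕ →₀ ℕ) (n : ℕ) : Prop where
  sum_eq : n = b.sum fun k d => d * convDen α k
  digit_zero : b 0 + 1 ≤ partQuot α 1
  digit_le : ∀ k, 1 ≤ k → b k ≤ partQuot α (k + 1)
  digit_rule : ∀ k, 1 ≤ k → b k = partQuot α (k + 1) → b (k - 1) = 0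

/-- The Sturmian word of slope `α` and intercept `θ` (used at indices `i ≥ 1`). -/
noncomputable def sturmianWord (α θ : ℝ) (i : ℕ) : ℤ :=
  ⌊((i : ℝ) + 1) * α + θ⌋ - ⌊(i : ℝ) * α + θ⌋

/-- The sum of the entries of the `m × n` submatrix of the Hankel matrix of the word `a`
whose upper left entry is `a i`. -/
def rectWeight (a : ℕ → ℤ) (i m n : ℕ) : ℤ :=
  ∑ k ∈ Finset.range m, ∑ l ∈ Finset.range n, a (i + k + l)

/-- The `m × n` rectangles of the word `a = a₁ a₂ a₃ ⋯` are balanced. -/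
def BalancedRectangles (a : ℕ → ℤ) (m n : ℕ) : Prop :=
  ∃ c : ℤ, ∀ i : ℕ, 1 ≤ i → rectWeight a i m n = c ∨ rectWeight a i m n = c + 1

/-!
The weight of the rectangle at position `i` is a function of the phase `i α + θ`, and by density of
the phases balance means that this function, a sum of `2 m` floors with jumps at the points
`-k α` and `-(n + k) α`, `k < m`, takes two consecutive values. As `x` moves around the circle,
jumps of both kinds must essentially alternate. By the three-gap structure of the points `k α`,
`k < m`, this happens exactly if `n α` is nearer to an integer than all `k α`, `0 < k < m`, or if
`m = q_{M-1} + a q_M` and `n α` lies slightly before one of certain points `n₀ α`. The Ostrowski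
digits of `n` give the position of `n α` relative to the multiples of `α`, which turns these two
alternatives into conditions on the digits.
-/

open Filter Topology

/-! ### Continued fractions -/

/-- The orbit of the fractional part of `α` under the Gauss map `x ↦ {1 / x}`. -/
noncomputable def gaussOrbit (α : ℝ) : ℕ → ℝ
  | 0 => Int.fract α
  | k + 1 => Int.fract (gaussOrbit α k)⁻¹

/-- The distances `|q α - p|` for the convergents `p / q` of `α`. As in `shiftDen` and `shiftNum`,
the entry at `0` belongs to the convention `q₋₁ = 0`, `p₋₁ = 1`, and that at `k + 1` to `qₖ`. -/
noncomputable def convErr (α : ℝ) : ℕ → ℝ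
  | 0 => 1
  | k + 1 => convErr α k * gaussOrbit α k

/-- The denominators `q₋₁ = 0, q₀, q₁, …` of the convergents. -/
noncomputable def shiftDen (α : ℝ) : ℕ → ℕ
  | 0 => 0
  | k + 1 => convDen α k

/-- The numerators `p₋₁ = 1, p₀, p₁, …` of the convergents. -/
noncomputable def shiftNum (α : ℝ) : ℕ → ℤ
  | 0 => 1
  | 1 => ⌊α⌋
  | k + 2 => partQuot α (k + 1) * shiftNum α (k + 1) + shiftNum α k

theorem irrational_gaussOrbit {α : ℝ} (hα : Irrational α) (k : ℕ) :
    Irrational (gaussOrbit α k) := by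
  induction k with
  | zero => exact hα.sub_intCast _
  | succ k ih => exact ih.inv.sub_intCast _

theorem gaussOrbit_pos {α : ℝ} (hα : Irrational α) (k : ℕ) : 0 < gaussOrbit α k := by
  have h0 : 0 ≤ gaussOrbit α k := by
    cases k <;> exact Int.fract_nonneg _
  exact h0.lt_of_ne (irrational_gaussOrbit hα k).ne_zero.symm

theorem gaussOrbit_lt_one (α : ℝ) (k : ℕ) : gaussOrbit α k < 1 := by
  cases k <;> exact Int.fract_lt_one _

theorem exists_stream_eq_gaussOrbit {α : ℝ} (hα : Irrational α) (k : ℕ) :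
    ∃ b : ℤ, GenContFract.IntFractPair.stream α k = some ⟨b, gaussOrbit α k⟩ := by
  induction k with
  | zero => exact ⟨⌊α⌋, rfl⟩
  | succ k ih =>
    obtain ⟨b, hb⟩ := ih
    exact ⟨⌊(gaussOrbit α k)⁻¹⌋,
      GenContFract.IntFractPair.stream_succ_of_some hb (gaussOrbit_pos hα k).ne'⟩

theorem partQuot_succ_eq_floor {α : ℝ} (hα : Irrational α) (k : ℕ) :
    (partQuot α (k + 1) : ℝ) = (⌊(gaussOrbit α k)⁻¹⌋ : ℝ) := by
  obtain ⟨b, hb⟩ := exists_stream_eq_gaussOrbit hα k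
  have hs := GenContFract.get?_of_eq_some_of_get?_intFractPair_stream_fr_ne_zero hb
    (gaussOrbit_pos hα k).ne'
  exact Option.some.inj ((partDens_get?_eq hα k).symm.trans (GenContFract.partDen_eq_s_b hs))

theorem one_le_partQuot_succ {α : ℝ} (hα : Irrational α) (k : ℕ) : 1 ≤ partQuot α (k + 1) := by
  have h : (1 : ℝ) ≤ partQuot α (k + 1) :=
    GenContFract.of_one_le_get?_partDen (partDens_get?_eq hα k)
  exact_mod_cast h

theorem convErr_pos {α : ℝ} (hα : Irrational α) (k : ℕ) : 0 < convErr α k := by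
  induction k with
  | zero => exact one_pos
  | succ k ih => exact mul_pos ih (gaussOrbit_pos hα k)

theorem convErr_succ_lt {α : ℝ} (hα : Irrational α) (k : ℕ) : convErr α (k + 1) < convErr α k :=
  mul_lt_of_lt_one_right (convErr_pos hα k) (gaussOrbit_lt_one α k)

theorem convErr_eq_mul_add {α : ℝ} (hα : Irrational α) (k : ℕ) :
    convErr α k = partQuot α (k + 1) * convErr α (k + 1) + convErr α (k + 2) := by
  have hg := (gaussOrbit_pos hα k).ne'
  simp only [convErr, gaussOrbit, Int.fract, ← partQuot_succ_eq_floor hα]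
  field_simp
  ring

theorem shiftDen_add_two (α : ℝ) (k : ℕ) :
    shiftDen α (k + 2) = partQuot α (k + 1) * shiftDen α (k + 1) + shiftDen α k := by
  cases k <;> simp [shiftDen, convDen]

theorem shiftDen_add_le {α : ℝ} (hα : Irrational α) (k : ℕ) :
    shiftDen α k + shiftDen α (k + 1) ≤ shiftDen α (k + 2) := by
  rw [shiftDen_add_two]
  linarith [Nat.le_mul_of_pos_left (shiftDen α (k + 1)) (one_le_partQuot_succ hα k)]

theorem monotone_shiftDen {α : ℝ} (hα : Irrational α) : Monotone (shiftDen α) := by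
  refine monotone_nat_of_le_succ fun k => ?_
  cases k with
  | zero => exact Nat.zero_le _
  | succ k => exact (Nat.le_add_left _ _).trans (shiftDen_add_le hα k)

theorem shiftDen_succ_pos {α : ℝ} (hα : Irrational α) (k : ℕ) : 0 < shiftDen α (k + 1) :=
  Nat.one_pos.trans_le (monotone_shiftDen hα (Nat.le_add_left 1 k))

theorem lt_shiftDen_add_two {α : ℝ} (hα : Irrational α) (k : ℕ) : k < shiftDen α (k + 2) := by
  induction k with
  | zero => exact shiftDen_succ_pos hα 1
  | succ k ih =>
    have h := shiftDen_add_le hα (k + 1)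
    have h0 := shiftDen_succ_pos hα k
    lia

theorem exists_shiftDen_lt_le {α : ℝ} (hα : Irrational α) {m : ℕ} (hm : 1 < m) :
    ∃ M, shiftDen α (M + 1) < m ∧ m ≤ shiftDen α (M + 2) := by
  have hex : ∃ k, m ≤ shiftDen α (k + 2) := ⟨m, (lt_shiftDen_add_two hα m).le⟩
  refine ⟨Nat.find hex, ?_, Nat.find_spec hex⟩
  rcases hM : Nat.find hex with _ | M
  · simpa [shiftDen, convDen] using hm
  · exact not_le.1 (Nat.find_min hex (hM ▸ M.lt_succ_self))

theorem shiftDen_mul_sub_shiftNum {α : ℝ} (hα : Irrational α) (k : ℕ) :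
    (shiftDen α k : ℝ) * α - shiftNum α k = (-1) ^ (k + 1) * convErr α k := by
  induction k using Nat.twoStepInduction with
  | zero => simp [shiftDen, shiftNum, convErr]
  | one => simp [shiftDen, shiftNum, convErr, convDen, gaussOrbit]
  | more k h0 h1 =>
    have herr : convErr α (k + 2) = convErr α k - partQuot α (k + 1) * convErr α (k + 1) := by
      linarith [convErr_eq_mul_add hα k]
    rw [shiftDen_add_two, shiftNum, herr]
    push_cast
    simp only [pow_succ] at h0 h1 ⊢
    linear_combination (partQuot α (k + 1) : ℝ) * h1 + h0

theorem shiftDen_shiftNum_det (α : ℝ) (k : ℕ) :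
    (shiftDen α (k + 1) : ℤ) * shiftNum α k - shiftDen α k * shiftNum α (k + 1) = (-1) ^ k := by
  induction k with
  | zero => simp [shiftDen, shiftNum, convDen]
  | succ k ih =>
    rw [shiftDen_add_two, shiftNum]
    push_cast
    rw [pow_succ]
    linear_combination -ih

/-! ### Rectangle sums as functions of the phase -/

/-- The weight of the `m × n` rectangle of the Sturmian word with slope `α`, as a function of the
phase `x = i α + θ` of its upper left corner. -/
noncomputable def rectPhase (α : ℝ) (m n : ℕ) (x : ℝ) : ℤ :=
  ∑ k ∈ Finset.range m, (⌊x + (k + n) * α⌋ - ⌊x + k * α⌋)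

/-- `rectPhase` takes at most two values, and these are consecutive. -/
def PhaseBalanced (α : ℝ) (m n : ℕ) : Prop :=
  ∃ c : ℤ, ∀ x : ℝ, rectPhase α m n x = c ∨ rectPhase α m n x = c + 1

theorem rectWeight_sturmianWord (α θ : ℝ) (i m n : ℕ) :
    rectWeight (sturmianWord α θ) i m n = rectPhase α m n (i * α + θ) := by
  refine Finset.sum_congr rfl fun k _ => ?_
  have htel := Finset.sum_range_sub (fun l : ℕ => ⌊((i + k + l : ℕ) : ℝ) * α + θ⌋) n
  calc ∑ l ∈ Finset.range n, sturmianWord α θ (i + k + l)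
      = ⌊((i + k + n : ℕ) : ℝ) * α + θ⌋ - ⌊((i + k + 0 : ℕ) : ℝ) * α + θ⌋ := by
        rw [← htel]
        refine Finset.sum_congr rfl fun l _ => ?_
        simp only [sturmianWord, Nat.cast_add, Nat.cast_one, add_assoc]
    _ = ⌊i * α + θ + (k + n) * α⌋ - ⌊i * α + θ + k * α⌋ := by
        push_cast
        ring_nf

theorem rectPhase_add_intCast (α : ℝ) (m n : ℕ) (x : ℝ) (l : ℤ) :
    rectPhase α m n (x + l) = rectPhase α m n x := by
  simp only [rectPhase, add_right_comm x (l : ℝ), Int.floor_add_intCast, add_sub_add_right_eq_sub]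

theorem eventually_rectPhase_eq (α : ℝ) (m n : ℕ) (x : ℝ) :
    ∀ᶠ y in 𝓝[>] x, rectPhase α m n y = rectPhase α m n x := by
  have hfloor (z : ℝ) : ∀ᶠ y in 𝓝[>] x, ⌊y + z⌋ = ⌊x + z⌋ := by
    have hshift : Tendsto (· + z) (𝓝[>] x) (𝓝[≥] (x + z)) :=
      tendsto_nhdsWithin_iff.2 ⟨((continuous_add_const z).tendsto x).mono_left nhdsWithin_le_nhds,
        eventually_nhdsWithin_of_forall fun y hy => by simpa using (Set.mem_Ioi.1 hy).le⟩
    exact tendsto_pure.1 ((tendsto_floor_right_pure_floor (x + z)).comp hshift)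
  have hterm : ∀ᶠ y in 𝓝[>] x, ∀ k ∈ Finset.range m,
      ⌊y + (k + n) * α⌋ - ⌊y + k * α⌋ = ⌊x + (k + n) * α⌋ - ⌊x + k * α⌋ := by
    refine (Filter.eventually_all_finset _).2 fun k _ => ?_
    filter_upwards [hfloor ((k + n) * α), hfloor (k * α)] with y h₁ h₂
    rw [h₁, h₂]
  exact hterm.mono fun y hy => Finset.sum_congr rfl hy

theorem exists_nat_mul_add_sub_mem {α : ℝ} (hα : Irrational α) (θ : ℝ) {U : Set ℝ}
    (hU : IsOpen U) (hne : U.Nonempty) : ∃ i : ℕ, 1 ≤ i ∧ ∃ l : ℤ, i * α + θ - l ∈ U := by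
  have hdense : DenseRange (· • (α : AddCircle (1 : ℝ)) : ℕ → AddCircle (1 : ℝ)) :=
    denseRange_zsmul_iff_nsmul.1 (AddCircle.denseRange_zsmul_coe_iff.2 (by simpa using hα))
  have hopen : IsOpen ((fun x : ℝ => (x : AddCircle (1 : ℝ))) '' ((· + (α + θ)) ⁻¹' U)) :=
    QuotientAddGroup.isOpenMap_coe _ (hU.preimage (continuous_add_const _))
  obtain ⟨u, hu⟩ := hne
  obtain ⟨j, y, hy, hyj⟩ := hdense.exists_mem_open hopen ⟨_, u - (α + θ), by simpa using hu, rfl⟩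
  obtain ⟨l, hl⟩ := (AddCircle.coe_eq_zero_iff 1 (x := j * α - y)).1 (by simp [hyj])
  refine ⟨j + 1, by simp, l, ?_⟩
  rw [zsmul_one] at hl
  have hyl : ((j + 1 : ℕ) : ℝ) * α + θ - l = y + (α + θ) := by
    push_cast
    linear_combination -hl
  rw [hyl]
  exact hy

theorem balancedRectangles_iff_phaseBalanced {α : ℝ} (hα : Irrational α) (θ : ℝ) (m n : ℕ) :
    BalancedRectangles (sturmianWord α θ) m n ↔ PhaseBalanced α m n := by
  constructor
  · rintro ⟨c, hc⟩
    refine ⟨c, fun x => ?_⟩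
    obtain ⟨b, hxb, hb⟩ := mem_nhdsGT_iff_exists_Ioo_subset.1 (eventually_rectPhase_eq α m n x)
    obtain ⟨i, hi, l, hl⟩ := exists_nat_mul_add_sub_mem hα θ isOpen_Ioo (Set.nonempty_Ioo.2 hxb)
    have hval : rectPhase α m n x = rectPhase α m n (i * α + θ) := by
      rw [← hb hl, ← rectPhase_add_intCast α m n _ l, sub_add_cancel]
    rw [hval, ← rectWeight_sturmianWord]
    exact hc i hi
  · rintro ⟨c, hc⟩
    exact ⟨c, fun i _ => rectWeight_sturmianWord α θ i m n ▸ hc _⟩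

theorem rectPhase_neg (α : ℝ) (m n : ℕ) (x : ℝ) :
    rectPhase (-α) m n x = -rectPhase α m n (x - (m - 1 + n) * α) := by
  rw [rectPhase, rectPhase, ← Finset.sum_range_reflect, ← Finset.sum_neg_distrib]
  refine Finset.sum_congr rfl fun k hk => ?_
  have hcast : ((m - 1 - k : ℕ) : ℝ) = m - 1 - k := by
    have hk := Finset.mem_range.1 hk
    rw [Nat.cast_sub (by lia), Nat.cast_sub (by lia), Nat.cast_one]
  rw [hcast, neg_sub]
  congr 2 <;> ring_nf

theorem PhaseBalanced.neg {α : ℝ} {m n : ℕ} (h : PhaseBalanced α m n) :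
    PhaseBalanced (-α) m n := by
  obtain ⟨c, hc⟩ := h
  refine ⟨-c - 1, fun x => ?_⟩
  rw [rectPhase_neg]
  rcases hc (x - (m - 1 + n) * α) with h | h <;> lia

theorem phaseBalanced_neg_one_pow_mul (α : ℝ) (m n k : ℕ) :
    PhaseBalanced ((-1) ^ k * α) m n ↔ PhaseBalanced α m n := by
  rcases neg_one_pow_eq_or ℝ k with h | h <;> rw [h]
  · rw [one_mul]
  · rw [neg_one_mul]
    exact ⟨fun h => by simpa using h.neg, PhaseBalanced.neg⟩

-- As the phase decreases from `-β₁` to `-h`, none of the subtracted floors changes, while two of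
-- the others drop.
theorem PhaseBalanced.not_two_points {α : ℝ} {m n : ℕ} (hb : PhaseBalanced α m n)
    {i j : ℕ} (hi : i < m) (hj : j < m) (hij : i ≠ j) {l₁ l₂ : ℤ} {β₁ β₂ h : ℝ}
    (h₁ : (n + i) * α - l₁ = β₁) (h₂ : (n + j) * α - l₂ = β₂) (h₁₂ : β₁ < β₂) (h₂h : β₂ < h)
    (hfree : ∀ k < m, ∀ l : ℤ, k * α - l ∉ Set.Ico β₁ h) : False := by
  have hsub : ∀ k < m, ⌊-β₁ + k * α⌋ = ⌊-h + k * α⌋ := by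
    refine fun k hk => le_antisymm ?_ (Int.floor_le_floor (by linarith))
    by_contra! hlt
    exact hfree k hk ⌊-β₁ + k * α⌋
      ⟨by linarith [Int.floor_le (-β₁ + k * α)], by linarith [Int.floor_lt.1 hlt]⟩
  have hadd (k : ℕ) : ⌊-h + (k + n) * α⌋ ≤ ⌊-β₁ + (k + n) * α⌋ :=
    Int.floor_le_floor (by linarith)
  have hjump {k : ℕ} {l : ℤ} (hk₁ : β₁ ≤ (n + k) * α - l) (hk₂ : (n + k) * α - l < h) :
      ⌊-h + (k + n) * α⌋ + 1 ≤ ⌊-β₁ + (k + n) * α⌋ :=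
    (Int.add_one_le_iff.2 (Int.floor_lt.2 (by linarith))).trans
      (Int.le_floor.2 (by linarith : (l : ℝ) ≤ _))
  have hsum : rectPhase α m n (-h) + 2 ≤ rectPhase α m n (-β₁) := by
    have htwo : ∑ k ∈ Finset.range m, ((if k = i then 1 else 0) + if k = j then 1 else 0)
        = (2 : ℤ) := by
      rw [Finset.sum_add_distrib, Finset.sum_ite_eq', Finset.sum_ite_eq',
        if_pos (Finset.mem_range.2 hi), if_pos (Finset.mem_range.2 hj), one_add_one_eq_two]
    rw [← htwo, rectPhase, rectPhase, ← Finset.sum_add_distrib]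
    refine Finset.sum_le_sum fun k hk => ?_
    rw [hsub k (Finset.mem_range.1 hk)]
    split_ifs with hki hkj hkj
    · exact absurd (hki.symm.trans hkj) hij
    · subst hki
      linarith [hjump h₁.ge (h₁ ▸ h₁₂.trans h₂h)]
    · subst hkj
      linarith [hjump (h₂ ▸ h₁₂.le) (h₂ ▸ h₂h)]
    · linarith [hadd k]
  obtain ⟨c, hc⟩ := hb
  rcases hc (-h) with h3 | h3 <;> rcases hc (-β₁) with h4 | h4 <;> lia

theorem rectPhase_add_slope (α : ℝ) (m n : ℕ) (x : ℝ) :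
    rectPhase α m n (x + α) - rectPhase α m n x
      = (⌊x + (m + n) * α⌋ - ⌊x + m * α⌋) - (⌊x + n * α⌋ - ⌊x⌋) := by
  have htel := Finset.sum_range_sub (fun k : ℕ => ⌊x + (k + n) * α⌋ - ⌊x + k * α⌋) m
  simp only [Nat.cast_zero, zero_add, zero_mul, add_zero] at htel
  rw [rectPhase, rectPhase, ← Finset.sum_sub_distrib, ← htel]
  refine Finset.sum_congr rfl fun k _ => ?_
  push_cast
  ring_nf

theorem floor_sub_eq_of_le_fract {x t : ℝ} (ht : 0 ≤ t) (hx : t ≤ Int.fract x) :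
    ⌊x - t⌋ = ⌊x⌋ :=
  Int.floor_eq_iff.2 ⟨by linarith [Int.self_sub_floor x], by linarith [Int.lt_floor_add_one x]⟩

theorem floor_add_eq_of_fract_add_lt_one {x t : ℝ} (ht : 0 ≤ t) (hx : Int.fract x + t < 1) :
    ⌊x + t⌋ = ⌊x⌋ :=
  Int.floor_eq_iff.2 ⟨by linarith [Int.floor_le x], by linarith [Int.self_sub_floor x]⟩

theorem rectPhase_eq_of_add_eq_intCast {α : ℝ} {m n j : ℕ} {y : ℝ} {l : ℤ} (h : y + j * α = l) :
    rectPhase α m n y = rectPhase α m n (-(j * α)) := by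
  rw [← rectPhase_add_intCast α m n (-(j * α)) l, ← h]
  congr 1
  ring

theorem exists_rectPhase_neg_mul_le (α : ℝ) {m : ℕ} (n : ℕ) (hm : 0 < m) (x : ℝ) :
    ∃ j < m, rectPhase α m n (-(j * α)) ≤ rectPhase α m n x := by
  obtain ⟨j, hj, hmin⟩ := Finset.exists_min_image (Finset.range m)
    (fun j : ℕ => Int.fract (x + j * α)) (Finset.nonempty_range_iff.2 hm.ne')
  set t := Int.fract (x + j * α)
  have ht0 : 0 ≤ t := Int.fract_nonneg _
  have hint : x - t + j * α = ⌊x + j * α⌋ := by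
    linarith [Int.self_sub_floor (x + j * α)]
  refine ⟨j, Finset.mem_range.1 hj, ?_⟩
  rw [← rectPhase_eq_of_add_eq_intCast hint]
  refine Finset.sum_le_sum fun k hk => ?_
  have hsub : ⌊x - t + k * α⌋ = ⌊x + k * α⌋ := by
    rw [sub_add_eq_add_sub, floor_sub_eq_of_le_fract ht0 (hmin k hk)]
  have hadd : ⌊x - t + (k + n) * α⌋ ≤ ⌊x + (k + n) * α⌋ := Int.floor_le_floor (by linarith)
  lia

theorem eq_of_fract_add_natCast_mul_eq {α : ℝ} (hα : Irrational α) {x : ℝ} {j k : ℕ}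
    (h : Int.fract (x + k * α) = Int.fract (x + j * α)) : k = j := by
  obtain ⟨l, hl⟩ := Int.fract_eq_fract.1 h
  by_contra hkj
  refine (hα.intCast_mul (sub_ne_zero.2 (Nat.cast_injective.ne hkj) : (k : ℤ) - j ≠ 0)).ne_int l ?_
  push_cast
  linarith

theorem exists_rectPhase_le_neg_mul_add_one {α : ℝ} (hα : Irrational α) {m : ℕ} (n : ℕ)
    (hm : 0 < m) (x : ℝ) : ∃ j < m, rectPhase α m n x ≤ rectPhase α m n (-(j * α)) + 1 := by
  obtain ⟨j, hj, hmax⟩ := Finset.exists_max_image (Finset.range m)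
    (fun j : ℕ => Int.fract (x + j * α)) (Finset.nonempty_range_iff.2 hm.ne')
  obtain ⟨t, ht⟩ : ∃ t, t = 1 - Int.fract (x + j * α) := ⟨_, rfl⟩
  have ht0 : 0 ≤ t := by linarith [Int.fract_lt_one (x + j * α)]
  have hint : x + t + j * α = (⌊x + j * α⌋ + 1 : ℤ) := by
    push_cast
    linarith [Int.self_sub_floor (x + j * α)]
  have hone : ∑ k ∈ Finset.range m, (if k = j then 1 else 0) = (1 : ℤ) := by
    rw [Finset.sum_ite_eq', if_pos hj]
  refine ⟨j, Finset.mem_range.1 hj, ?_⟩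
  rw [← rectPhase_eq_of_add_eq_intCast hint, ← hone, rectPhase, rectPhase,
    ← Finset.sum_add_distrib]
  refine Finset.sum_le_sum fun k hk => ?_
  have hadd : ⌊x + (k + n) * α⌋ ≤ ⌊x + t + (k + n) * α⌋ := Int.floor_le_floor (by linarith)
  split_ifs with hkj
  · rw [hkj, hint, Int.floor_intCast, ← hkj]
    lia
  · have hlt : Int.fract (x + k * α) < Int.fract (x + j * α) :=
      (hmax k hk).lt_of_ne fun h => hkj (eq_of_fract_add_natCast_mul_eq hα h)
    have hsub : ⌊x + t + k * α⌋ = ⌊x + k * α⌋ := by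
      rw [add_right_comm, floor_add_eq_of_fract_add_lt_one ht0 (by linarith)]
    lia

theorem phaseBalanced_of_floor_eq {α : ℝ} (hα : Irrational α) {m n : ℕ} (hm : 0 < m)
    (h : ∀ k : ℕ, 0 < k → k < m →
      ⌊-(k * α) + (m + n) * α⌋ - ⌊-(k * α) + m * α⌋ = ⌊-(k * α) + n * α⌋ - ⌊-(k * α)⌋) :
    PhaseBalanced α m n := by
  have hconst : ∀ j : ℕ, j < m → rectPhase α m n (-(j * α)) = rectPhase α m n 0 := by
    intro j hj
    induction j with
    | zero => simp
    | succ j ih =>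
      have hstep := rectPhase_add_slope α m n (-((j + 1 : ℕ) * α))
      have hprev : -((j + 1 : ℕ) * α) + α = -(j * α) := by
        push_cast
        ring
      rw [h (j + 1) j.succ_pos hj, sub_self, hprev, ih (by lia)] at hstep
      linarith
  refine ⟨rectPhase α m n 0, fun x => ?_⟩
  obtain ⟨i, hi, hlow⟩ := exists_rectPhase_neg_mul_le α n hm x
  obtain ⟨j, hj, hhigh⟩ := exists_rectPhase_le_neg_mul_add_one hα n hm x
  rw [hconst i hi] at hlow
  rw [hconst j hj] at hhigh
  lia

/-! ### Gaps between the points `k α` on the circle -/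

/-- A unimodular pair of a lower approximation `p / u` and an upper approximation `p' / v` of `α`,
the error `δ` of the former being smaller than the error `ε` of the latter. For `u, v < m ≤ u + v`
the gaps between the points `k α`, `k < m`, on the circle have lengths `δ`, `ε` and `δ + ε`. -/
structure GapBasis (α : ℝ) (u v : ℕ) (p p' : ℤ) (δ ε : ℝ) : Prop where
  lower : (u : ℝ) * α - p = δ
  upper : (v : ℝ) * α - p' = -ε
  det : (u : ℤ) * p' - v * p = 1
  pos : 0 < δ
  lt : δ < ε

namespace GapBasis

variable {α δ ε : ℝ} {u v : ℕ} {p p' : ℤ}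

theorem exists_coords (H : GapBasis α u v p p' δ ε) (k l : ℤ) :
    ∃ x y : ℤ, k = x * u + y * v ∧ (k : ℝ) * α - l = x * δ - y * ε := by
  have hk : k = (k * p' - l * v) * u + (l * u - k * p) * v := by linear_combination -k * H.det
  have hl : l = (k * p' - l * v) * p + (l * u - k * p) * p' := by linear_combination -l * H.det
  refine ⟨_, _, hk, ?_⟩
  have hk' : (k : ℝ) = (k * p' - l * v) * u + (l * u - k * p) * v := by exact_mod_cast hk
  have hl' : (l : ℝ) = (k * p' - l * v) * p + (l * u - k * p) * p' := by exact_mod_cast hl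
  push_cast
  linear_combination
    α * hk' - hl' + (k * p' - l * v : ℝ) * H.lower + (l * u - k * p : ℝ) * H.upper

theorem cases_of_pos (H : GapBasis α u v p p' δ ε) {k l : ℤ} (h : 0 < (k : ℝ) * α - l) :
    (u + v : ℤ) ≤ k ∨ (u : ℤ) ≤ k ∧ δ ≤ k * α - l ∨
      k ≤ -(u + v : ℤ) ∨ k ≤ -(v : ℤ) ∧ ε ≤ k * α - l ∨ δ + ε ≤ k * α - l := by
  obtain ⟨x, y, hk, hval⟩ := H.exists_coords k l
  have hδ := H.pos
  have hδε := H.lt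
  rw [hval] at h ⊢
  rcases lt_trichotomy y 0 with hy | rfl | hy
  · have hy' : (y : ℝ) ≤ -1 := by exact_mod_cast (by lia : y ≤ -1)
    rcases lt_trichotomy x 0 with hx | rfl | hx
    · exact .inr (.inr (.inl (by nlinarith)))
    · exact .inr (.inr (.inr (.inl ⟨by nlinarith, by push_cast; nlinarith⟩)))
    · have hx' : (1 : ℝ) ≤ x := by exact_mod_cast hx
      exact .inr (.inr (.inr (.inr (by nlinarith))))
  · have hx : 0 < x := by
      rw [Int.cast_zero, zero_mul, sub_zero] at h
      exact_mod_cast pos_of_mul_pos_left h hδ.le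
    have hx' : (1 : ℝ) ≤ x := by exact_mod_cast hx
    exact .inr (.inl ⟨by nlinarith, by push_cast; nlinarith⟩)
  · have hy' : (1 : ℝ) ≤ y := by exact_mod_cast hy
    have hx : 0 < x := by
      by_contra! hx
      have hx' : (x : ℝ) ≤ 0 := by exact_mod_cast hx
      nlinarith
    exact .inl (by nlinarith)

theorem notMem_Ioo_long (H : GapBasis α u v p p' δ ε) {k l : ℤ} (hk₁ : -(u + v : ℤ) < k)
    (hk₂ : k < u) : (k : ℝ) * α - l ∉ Set.Ioo 0 ε := by
  rintro ⟨h0, h1⟩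
  have hδ := H.pos
  rcases H.cases_of_pos h0 with h | h | h | h | h <;> first | lia | linarith

theorem notMem_Ioo_short (H : GapBasis α u v p p' δ ε) {k l : ℤ} (hk : |k| < u + v) :
    (k : ℝ) * α - l ∉ Set.Ioo 0 δ := by
  rintro ⟨h0, h1⟩
  have hδε := H.lt
  rw [abs_lt] at hk
  rcases H.cases_of_pos h0 with h | h | h | h | h <;> first | lia | linarith

theorem notMem_Ioo_sum (H : GapBasis α u v p p' δ ε) {k l : ℤ} (hk₁ : -(v : ℤ) < k)
    (hk₂ : k < u) : (k : ℝ) * α - l ∉ Set.Ioo 0 (δ + ε) := by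
  rintro ⟨h0, h1⟩
  rcases H.cases_of_pos h0 with h | h | h | h | h <;> first | lia | linarith

theorem lower_le_abs (H : GapBasis α u v p p' δ ε) {k l : ℤ} (hk : |k| < u + v)
    (h0 : (k : ℝ) * α - l ≠ 0) : δ ≤ |k * α - l| := by
  by_contra! hlt
  rcases h0.lt_or_gt with h | h
  · refine H.notMem_Ioo_short (k := -k) (l := -l) (by rwa [abs_neg]) ⟨?_, ?_⟩ <;> push_cast
    · linarith
    · linarith [abs_lt.1 hlt]
  · exact H.notMem_Ioo_short hk ⟨h, (le_abs_self _).trans_lt hlt⟩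

theorem upper_le_abs (H : GapBasis α u v p p' δ ε) {k l : ℤ} (hk : |k| < u)
    (h0 : (k : ℝ) * α - l ≠ 0) : ε ≤ |k * α - l| := by
  by_contra! hlt
  have hk' := abs_lt.1 hk
  rcases h0.lt_or_gt with h | h
  · refine H.notMem_Ioo_long (k := -k) (l := -l) (by lia) (by lia) ⟨?_, ?_⟩ <;> push_cast
    · linarith
    · linarith [abs_lt.1 hlt]
  · exact H.notMem_Ioo_long (by lia) hk'.2 ⟨h, (le_abs_self _).trans_lt hlt⟩

theorem notMem_Ioo_after_long (H : GapBasis α u v p p' δ ε) {i m : ℕ} {c : ℤ} {g : ℝ}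
    (hg : i * α - c = g) (hvi : v ≤ i) (hi : i < u + v) (hm : m ≤ u + v) :
    ∀ k < m, ∀ l : ℤ, k * α - l ∉ Set.Ioo g (g + ε) := by
  rintro k hk l ⟨h1, h2⟩
  refine H.notMem_Ioo_long (k := k - i) (l := l - c) (by lia) (by lia) ⟨?_, ?_⟩ <;>
    push_cast <;> linarith

theorem notMem_Ioo_after_sum (H : GapBasis α u v p p' δ ε) {i m : ℕ} {c : ℤ} {g : ℝ}
    (hg : i * α - c = g) (hi : i < v) (hm : m ≤ i + u) :
    ∀ k < m, ∀ l : ℤ, k * α - l ∉ Set.Ioo g (g + (δ + ε)) := by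
  rintro k hk l ⟨h1, h2⟩
  refine H.notMem_Ioo_sum (k := k - i) (l := l - c) (by lia) (by lia) ⟨?_, ?_⟩ <;>
    push_cast <;> linarith

end GapBasis

/-! ### Sufficient conditions for balance -/

theorem floor_sub_eq_of_forall_notMem {x t : ℝ} (ht : 0 ≤ t)
    (h : ∀ c : ℤ, x - c ∉ Set.Ico 0 t) : ⌊x - t⌋ = ⌊x⌋ :=
  floor_sub_eq_of_le_fract ht <| not_lt.1 fun hlt => h ⌊x⌋ ⟨Int.fract_nonneg x, hlt⟩

theorem floor_add_eq_of_forall_abs_lt {x y : ℝ} (h : ∀ c : ℤ, |y| < |x - c|) :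
    ⌊x + y⌋ = ⌊x⌋ := by
  rcases le_total 0 y with hy | hy
  · rw [← floor_sub_eq_of_forall_notMem (x := x + y) hy fun c hc => (h c).not_ge ?_,
      add_sub_cancel_right]
    rw [abs_of_nonneg hy, abs_le]
    constructor <;> linarith [hc.1, hc.2]
  · rw [← floor_sub_eq_of_forall_notMem (x := x) (neg_nonneg.2 hy) fun c hc => (h c).not_ge ?_,
      sub_neg_eq_add]
    rw [abs_of_nonneg hc.1, abs_of_nonpos hy]
    exact hc.2.le

theorem phaseBalanced_of_abs_lt {α : ℝ} (hα : Irrational α) {m n : ℕ} (hm : 0 < m) (l : ℤ)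
    (h : ∀ k : ℕ, 0 < k → k < m → ∀ c : ℤ, |n * α - l| < |k * α - c|) : PhaseBalanced α m n := by
  refine phaseBalanced_of_floor_eq hα hm fun k hk hkm => ?_
  have hm_shift : ⌊-(k * α) + m * α + (n * α - l)⌋ = ⌊-(k * α) + m * α⌋ := by
    refine floor_add_eq_of_forall_abs_lt fun c => ?_
    convert h (m - k) (by lia) (by lia) c using 2
    rw [Nat.cast_sub hkm.le]
    ring
  have hzero_shift : ⌊-(k * α) + (n * α - l)⌋ = ⌊-(k * α)⌋ := by
    refine floor_add_eq_of_forall_abs_lt fun c => ?_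
    have hneg : k * α - (-c : ℤ) = -(-(k * α) - c) := by
      push_cast
      ring
    simpa only [hneg, abs_neg] using h k hk hkm (-c)
  have hm_add : -(k * α) + (m + n) * α = -(k * α) + m * α + (n * α - l) + l := by ring
  have hzero_add : -(k * α) + n * α = -(k * α) + (n * α - l) + l := by ring
  rw [hm_add, hzero_add, Int.floor_add_intCast, Int.floor_add_intCast, hm_shift, hzero_shift]
  ring

namespace GapBasis

variable {α δ ε : ℝ} {u v : ℕ} {p p' : ℤ}

theorem phaseBalanced_of_near (H : GapBasis α u v p p' δ ε) (hα : Irrational α) {m n : ℕ}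
    (hm : 0 < m) (hmuv : m ≤ u + v) {l : ℤ} (hl : |n * α - l| < δ) : PhaseBalanced α m n :=
  phaseBalanced_of_abs_lt hα hm l fun k hk hkm c =>
    hl.trans_le <| H.lower_le_abs (k := k) (abs_lt.2 (by lia)) <|
      sub_ne_zero.2 ((hα.intCast_mul (by lia)).ne_int c)

-- `m α = (u + v) α` lies `ε - δ` below an integer, so the floors that
-- `phaseBalanced_of_floor_eq` compares differ by a shift of length `ε - δ`.
theorem phaseBalanced_of_next (H : GapBasis α u v p p' δ ε) (hα : Irrational α) {n n₀ : ℕ}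
    {l : ℤ} {z : ℝ} (hn : n * α - l = n₀ * α - z) (hz0 : 0 < z) (hz : z < δ)
    (hn₀ : n₀ < u + v) (hz' : u ≤ n₀ → z < 2 * δ - ε) : PhaseBalanced α (u + v) n := by
  refine phaseBalanced_of_floor_eq hα (by lia) fun k hk hkm => ?_
  have hδε := H.lt
  have hm : ((u + v : ℕ) : ℝ) * α = (p + p' : ℤ) - (ε - δ) := by
    push_cast
    linear_combination H.lower + H.upper
  have hshift : ⌊-(k * α) - (ε - δ)⌋ = ⌊-(k * α)⌋ := by
    refine floor_sub_eq_of_forall_notMem (by linarith) fun c hc => ?_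
    have hc0 : -(k * α) - c ≠ 0 :=
      sub_ne_zero.2 ((hα.natCast_mul hk.ne').neg.ne_int c)
    refine H.notMem_Ioo_long (k := -k) (l := c) (by lia) (by lia) ⟨?_, ?_⟩ <;> push_cast
    · linarith [hc.1.lt_of_ne hc0.symm]
    · linarith [hc.2, H.pos]
  have hshift_n : ⌊-(k * α) + n * α - (ε - δ)⌋ = ⌊-(k * α) + n * α⌋ := by
    refine floor_sub_eq_of_forall_notMem (by linarith) fun c hc => ?_
    have hpos : 0 < ((n₀ - k : ℤ) : ℝ) * α - (c - l : ℤ) := by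
      push_cast
      linarith [hc.1]
    have hlt : ((n₀ - k : ℤ) : ℝ) * α - (c - l : ℤ) < ε - δ + z := by
      push_cast
      linarith [hc.2]
    rcases lt_or_ge n₀ u with hu | hu
    · exact H.notMem_Ioo_long (by lia) (by lia) ⟨hpos, by linarith⟩
    · exact H.notMem_Ioo_short (by rw [abs_lt]; lia) ⟨hpos, by linarith [hz' hu]⟩
  have hadd : -(k * α) + ((u + v : ℕ) + n) * α
      = -(k * α) + n * α - (ε - δ) + (p + p' : ℤ) := by
    linear_combination hm
  have hzero_add : -(k * α) + (u + v : ℕ) * α = -(k * α) - (ε - δ) + (p + p' : ℤ) := by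
    linear_combination hm
  rw [hadd, hzero_add, Int.floor_add_intCast, Int.floor_add_intCast, hshift, hshift_n]
  ring

end GapBasis

/-! ### Necessary conditions for balance -/

theorem exists_next_point {α : ℝ} (hα : Irrational α) {m n : ℕ} (hm : 0 < m) (hmn : m ≤ n) :
    ∃ n₀ < m, ∃ (l : ℤ) (z : ℝ), n * α - l = n₀ * α - z ∧ 0 < z ∧
      ∀ k < m, ∀ c : ℤ, k * α - c ∉ Set.Ico (n₀ * α - z) (n₀ * α) := by
  obtain ⟨n₀, hn₀, hmin⟩ := Finset.exists_min_image (Finset.range m)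
    (fun k : ℕ => Int.fract (k * α - n * α)) (Finset.nonempty_range_iff.2 hm.ne')
  rw [Finset.mem_range] at hn₀
  set z := Int.fract (n₀ * α - n * α)
  have hnz : n * α - (-⌊n₀ * α - n * α⌋ : ℤ) = n₀ * α - z := by
    push_cast
    linarith [Int.self_sub_floor (n₀ * α - n * α)]
  refine ⟨n₀, hn₀, _, z, hnz, Int.fract_pos.2 fun h => ?_, fun k hk c hc => ?_⟩
  · refine (hα.intCast_mul (by lia : (n₀ - n : ℤ) ≠ 0)).ne_int ⌊n₀ * α - n * α⌋ ?_
    push_cast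
    linarith
  · have hfract : Int.fract (k * α - n * α) = k * α - c - (n₀ * α - z) := by
      refine Int.fract_eq_iff.2 ⟨by linarith [hc.1], ?_, c + ⌊n₀ * α - n * α⌋, ?_⟩
      · linarith [hc.2, Int.fract_lt_one (n₀ * α - n * α)]
      push_cast at hnz ⊢
      linarith
    have hle := hmin k (Finset.mem_range.2 hk)
    rw [hfract] at hle
    linarith [hc.2]

namespace GapBasis

variable {α δ ε : ℝ} {u v : ℕ} {p p' : ℤ}

theorem lt_of_next_point (H : GapBasis α u v p p' δ ε) (hα : Irrational α) {m n n₀ : ℕ} {l : ℤ}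
    {z : ℝ} (hb : PhaseBalanced α m n) (hu : 0 < u) (hum : u < m) (hn₀ : n₀ < m)
    (hn : n * α - l = n₀ * α - z)
    (hfree : ∀ k < m, ∀ c : ℤ, k * α - c ∉ Set.Ico (n₀ * α - z) (n₀ * α)) : z < δ := by
  have hδ := H.pos
  have hlow := H.lower
  by_contra! hz
  rcases le_or_gt u n₀ with hun | hun
  · refine hfree (n₀ - u) (by lia) (-p) ?_
    rw [Nat.cast_sub hun]
    push_cast
    constructor <;> linarith
  rcases hz.eq_or_lt with hz | hz
  · refine (hα.intCast_mul (by lia : (n + u - n₀ : ℤ) ≠ 0)).ne_int (l + p) ?_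
    push_cast
    linarith
  · refine hb.not_two_points (i := 0) (j := u) (l₁ := l) (l₂ := l + p) (β₁ := n₀ * α - z)
      (β₂ := n₀ * α - z + δ) (h := n₀ * α) (by lia) hum (by lia) ?_ ?_ (by linarith)
      (by linarith) hfree <;> push_cast <;> linarith

theorem le_of_lt_next_point (H : GapBasis α u v p p' δ ε) {m n n₀ : ℕ} {l : ℤ} {z h : ℝ}
    (hb : PhaseBalanced α m n) (hu : 0 < u) (hun₀ : u < n₀) (hn₀ : n₀ < m)
    (hn : n * α - l = n₀ * α - z) (hz : z < δ)
    (hfree : ∀ k < m, ∀ c : ℤ, k * α - c ∉ Set.Ioo (m * α - δ) h) : h ≤ m * α - z + δ := by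
  by_contra! hlt
  obtain ⟨i, rfl⟩ := Nat.exists_eq_add_of_lt hn₀
  refine hb.not_two_points (i := i + 1) (j := i + 1 + u) (l₁ := l) (l₂ := l + p)
    (β₁ := (n₀ + i + 1 : ℕ) * α - z) (β₂ := (n₀ + i + 1 : ℕ) * α - z + δ)
    (by lia) (by lia) (by lia) ?_ ?_ (by linarith [H.pos]) hlt
    fun k hk c hc => hfree k hk c ⟨by linarith [hc.1], hc.2⟩ <;> push_cast
  · linear_combination hn
  · linear_combination hn + H.lower

-- The points `(m - n₀) α` and `(m - n₀ - v) α` shifted by `n α` lie in one gap after `(m - u) α`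
-- or, if `m < n₀ + v`, the points `0` and `v α` shifted by `n α` lie in the gap before `n₀ α`.
theorem not_next_point_lt (H : GapBasis α u v p p' δ ε) {m n n₀ : ℕ} {l : ℤ} {z : ℝ}
    (hb : PhaseBalanced α m n) (hv : 0 < v) (hum : u < m) (hvm : v < m) (hm : m < u + v)
    (hn₀ : 0 < n₀) (hn₀u : n₀ < u) (hn : n * α - l = n₀ * α - z) (hz0 : 0 < z) (hz : z < δ) :
    False := by
  have hlow := H.lower
  have hupp := H.upper
  have hδε := H.lt
  rcases le_or_gt (n₀ + v) m with hnv | hnv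
  · obtain ⟨i, rfl⟩ := Nat.exists_eq_add_of_le hnv
    have hg : (n₀ + v + i - u : ℕ) * α - (-p : ℤ) = (n₀ + v + i : ℕ) * α - δ := by
      rw [Nat.cast_sub hum.le]
      push_cast
      linarith
    have hgap := H.notMem_Ioo_after_sum hg (by lia) (m := n₀ + v + i) (by lia)
    refine hb.not_two_points (i := i + v) (j := i) (l₁ := l) (l₂ := l - p')
      (β₁ := (n₀ + v + i : ℕ) * α - z) (β₂ := (n₀ + v + i : ℕ) * α - z + ε)
      (h := (n₀ + v + i : ℕ) * α + ε) (by lia) (by lia) (by lia) ?_ ?_ (by linarith) (by linarith)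
      fun k hk c hc => hgap k hk c ⟨by linarith [hc.1], by linarith [hc.2]⟩ <;> push_cast
    · linear_combination hn
    · linear_combination hn - H.upper
  · have hg : (n₀ + v - u : ℕ) * α - (p' - p : ℤ) = n₀ * α - (δ + ε) := by
      rw [Nat.cast_sub (by lia)]
      push_cast
      linarith
    have hgap := H.notMem_Ioo_after_sum hg (by lia) (m := m) (by lia)
    refine hb.not_two_points (i := v) (j := 0) (l₁ := l + p') (l₂ := l) (β₁ := n₀ * α - z - ε)
      (β₂ := n₀ * α - z) (h := n₀ * α) (by lia) (by lia) (by lia) ?_ ?_ (by linarith) (by linarith)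
      fun k hk c hc => hgap k hk c ⟨by linarith [hc.1], by linarith [hc.2]⟩ <;> push_cast
    · linear_combination hn + H.upper
    · linear_combination hn

theorem not_lt_next_point_of_lt_add (H : GapBasis α u v p p' δ ε) {m n n₀ : ℕ} {l : ℤ} {z : ℝ}
    (hb : PhaseBalanced α m n) (hu : 0 < u) (hum : u < m) (hm : m < u + v) (hun₀ : u < n₀)
    (hn₀ : n₀ < m) (hn : n * α - l = n₀ * α - z) (hz0 : 0 < z) (hz : z < δ) : False := by
  have hg : (m - u : ℕ) * α - (-p : ℤ) = m * α - δ := by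
    rw [Nat.cast_sub hum.le]
    push_cast
    linarith [H.lower]
  have hle := H.le_of_lt_next_point hb hu hun₀ hn₀ hn hz
    (H.notMem_Ioo_after_sum hg (by lia) (by lia))
  linarith [H.lt]

theorem lt_of_lt_next_point (H : GapBasis α u v p p' δ ε) (hα : Irrational α) {n n₀ : ℕ} {l : ℤ}
    {z : ℝ} (hb : PhaseBalanced α (u + v) n) (hu : 0 < u) (hun₀ : u < n₀) (hn₀ : n₀ < u + v)
    (hn : n * α - l = n₀ * α - z) (hz : z < δ) : z < 2 * δ - ε := by
  have hg : v * α - (-p : ℤ) = (u + v : ℕ) * α - δ := by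
    push_cast
    linarith [H.lower]
  have hle := H.le_of_lt_next_point hb hu hun₀ hn₀ hn hz
    (H.notMem_Ioo_after_long hg le_rfl (by lia) le_rfl)
  refine lt_of_le_of_ne (by linarith) fun hz' => ?_
  refine (hα.natCast_mul (by lia : n + 2 * u + v - n₀ ≠ 0)).ne_int (l + 2 * p + p') ?_
  rw [Nat.cast_sub (by lia)]
  push_cast
  linarith [H.lower, H.upper]

theorem near_or_next_of_phaseBalanced (H : GapBasis α u v p p' δ ε) (hα : Irrational α)
    {m n : ℕ} (hu : 0 < u) (hum : u < m) (hv : 0 < v) (hvm : v < m) (hm : m ≤ u + v)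
    (hmn : m ≤ n) (hb : PhaseBalanced α m n) :
    (∃ l : ℤ, |n * α - l| < δ) ∨
      m = u + v ∧ ∃ n₀ < m, ∃ (l : ℤ) (z : ℝ), n * α - l = n₀ * α - z ∧ 0 < z ∧ z < δ ∧
        (u ≤ n₀ → z < 2 * δ - ε) := by
  obtain ⟨n₀, hn₀, l, z, hn, hz0, hfree⟩ := exists_next_point hα (by lia) hmn
  have hz := H.lt_of_next_point hα hb hu hum hn₀ hn hfree
  rcases n₀.eq_zero_or_pos with rfl | hpos
  · refine .inl ⟨l, abs_lt.2 ?_⟩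
    rw [Nat.cast_zero] at hn
    constructor <;> linarith
  rcases lt_trichotomy n₀ u with hnu | rfl | hnu
  · rcases hm.lt_or_eq with hlt | heq
    · exact (H.not_next_point_lt hb hv hum hvm hlt hpos hnu hn hz0 hz).elim
    · exact .inr ⟨heq, n₀, hn₀, l, z, hn, hz0, hz, fun h => absurd hnu h.not_gt⟩
  · refine .inl ⟨l + p, abs_lt.2 ?_⟩
    have hlow := H.lower
    push_cast
    constructor <;> linarith
  · rcases hm.lt_or_eq with hlt | rfl
    · exact (H.not_lt_next_point_of_lt_add hb hu hum hlt hnu hn₀ hn hz0 hz).elim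
    · exact .inr ⟨rfl, n₀, hn₀, l, z, hn, hz0, hz,
        fun _ => H.lt_of_lt_next_point hα hb hu hnu hn₀ hn hz⟩

end GapBasis

theorem gapBasis_convergent {α : ℝ} (hα : Irrational α) (K : ℕ) {r : ℕ}
    (hr : r < partQuot α (K + 1)) :
    GapBasis ((-1) ^ K * α) (shiftDen α (K + 1)) (shiftDen α K + r * shiftDen α (K + 1))
      ((-1) ^ K * shiftNum α (K + 1))
      ((-1) ^ K * (shiftNum α K + r * shiftNum α (K + 1)))
      (convErr α (K + 1)) (convErr α K - r * convErr α (K + 1)) where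
  lower := by
    have herr := shiftDen_mul_sub_shiftNum hα (K + 1)
    rcases neg_one_pow_eq_or ℝ K with h | h <;>
      simp only [pow_succ, h, Int.cast_mul, Int.cast_pow, Int.cast_neg, Int.cast_one] at herr ⊢ <;>
      linarith
  upper := by
    have herr := shiftDen_mul_sub_shiftNum hα (K + 1)
    have herr₀ := shiftDen_mul_sub_shiftNum hα K
    push_cast
    rcases neg_one_pow_eq_or ℝ K with h | h <;> simp only [pow_succ, h] at herr herr₀ ⊢
    · linear_combination herr₀ + r * herr
    · linear_combination -herr₀ - r * herr
  det := by
    have hdet := shiftDen_shiftNum_det α K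
    rcases neg_one_pow_eq_or ℤ K with h | h <;> rw [h] at hdet ⊢ <;> push_cast
    · linear_combination hdet
    · linear_combination -hdet
  pos := convErr_pos hα _
  lt := by
    have hr' : (r : ℝ) + 1 ≤ partQuot α (K + 1) := by exact_mod_cast hr
    nlinarith [convErr_eq_mul_add hα K, convErr_pos hα (K + 1), convErr_pos hα (K + 2)]

/-! ### Ostrowski representations -/

/-- The part `∑_{k < K} d k * q k` of an Ostrowski representation. -/
noncomputable def ostLow (α : ℝ) (d : ℕ →₀ ℕ) (K : ℕ) : ℕ :=
  ∑ k ∈ Finset.range K, d k * shiftDen α (k + 1)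

/-- The number `(-1) ^ K * ∑_{k ≥ K} d k * (q k * α - p k)`. -/
noncomputable def ostTail (α : ℝ) (d : ℕ →₀ ℕ) (K : ℕ) : ℝ :=
  (-1) ^ K * ((d.sum fun k c => c * ((-1) ^ k * convErr α (k + 1)))
    - ∑ k ∈ Finset.range K, d k * ((-1) ^ k * convErr α (k + 1)))

/-- The first nonzero digit at a position `≥ K` exists and has the position `K + 2 * t`. -/
def EvenLead (d : ℕ →₀ ℕ) (K : ℕ) : Prop :=
  ∃ t, (∀ k, K ≤ k → k < K + 2 * t → d k = 0) ∧ d (K + 2 * t) ≠ 0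

theorem exists_ge_forall_eq_zero (d : ℕ →₀ ℕ) (K : ℕ) :
    ∃ T, K ≤ T ∧ ∀ k, T ≤ k → d k = 0 := by
  obtain ⟨T, hT⟩ := d.support.exists_nat_subset_range
  refine ⟨max T K, le_max_right _ _, fun k hk => Finsupp.notMem_support_iff.1 fun hmem => ?_⟩
  exact (Finset.mem_range.1 (hT hmem)).not_ge ((le_max_left _ _).trans hk)

theorem finsuppSum_eq_sum_range {R : Type*} [AddCommMonoid R] {d : ℕ →₀ ℕ} {f : ℕ → ℕ → R}
    (hf : ∀ k, f k 0 = 0) {T : ℕ} (hT : ∀ k, T ≤ k → d k = 0) :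
    d.sum f = ∑ k ∈ Finset.range T, f k (d k) := by
  refine d.sum_of_support_subset (fun k hk => ?_) f fun k _ => hf k
  rw [Finset.mem_range]
  by_contra! hTk
  exact Finsupp.mem_support_iff.1 hk (hT k hTk)

theorem ostLow_succ (α : ℝ) (d : ℕ →₀ ℕ) (K : ℕ) :
    ostLow α d (K + 1) = ostLow α d K + d K * shiftDen α (K + 1) :=
  Finset.sum_range_succ _ _

theorem ostLow_eq_zero_iff {α : ℝ} (hα : Irrational α) (d : ℕ →₀ ℕ) (K : ℕ) :
    ostLow α d K = 0 ↔ ∀ k < K, d k = 0 := by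
  simp only [ostLow, Finset.sum_eq_zero_iff, Finset.mem_range, mul_eq_zero,
    (shiftDen_succ_pos hα _).ne', or_false]

theorem ostTail_eq_sub (α : ℝ) (d : ℕ →₀ ℕ) (K : ℕ) :
    ostTail α d K = d K * convErr α (K + 1) - ostTail α d (K + 1) := by
  rw [ostTail, ostTail, Finset.sum_range_succ]
  rcases neg_one_pow_eq_or ℝ K with h | h <;> rw [pow_succ, h] <;> ring

theorem ostTail_eq_zero (α : ℝ) {d : ℕ →₀ ℕ} {K : ℕ} (hd : ∀ k, K ≤ k → d k = 0) :
    ostTail α d K = 0 := by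
  rw [ostTail, finsuppSum_eq_sum_range (by simp) hd, sub_self, mul_zero]

theorem ostTail_eq_neg_one_pow_mul (α : ℝ) {d : ℕ →₀ ℕ} {K i : ℕ}
    (hd : ∀ k, K ≤ k → k < K + i → d k = 0) :
    ostTail α d K = (-1) ^ i * ostTail α d (K + i) := by
  induction i with
  | zero => rw [pow_zero, one_mul, add_zero]
  | succ i ih =>
    rw [ih fun k hk hki => hd k hk (by lia), ostTail_eq_sub α d (K + i),
      hd (K + i) (by lia) (by lia), pow_succ, add_assoc]
    push_cast
    ring

namespace IsOstrowski

variable {α : ℝ} {d : ℕ →₀ ℕ} {n : ℕ}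

theorem eq_ostLow (h : IsOstrowski α d n) {T : ℕ} (hT : ∀ k, T ≤ k → d k = 0) :
    n = ostLow α d T := by
  rw [h.sum_eq, finsuppSum_eq_sum_range (by simp) hT]
  rfl

theorem ostLow_le (h : IsOstrowski α d n) (K : ℕ) : ostLow α d K ≤ n := by
  obtain ⟨T, hKT, hT⟩ := exists_ge_forall_eq_zero d K
  rw [h.eq_ostLow hT]
  exact Finset.sum_le_sum_of_subset (Finset.range_mono hKT)

theorem digit_le_partQuot (h : IsOstrowski α d n) (k : ℕ) : d k ≤ partQuot α (k + 1) := by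
  rcases k.eq_zero_or_pos with rfl | hk
  · exact (Nat.le_succ _).trans h.digit_zero
  · exact h.digit_le k hk

theorem ostLow_lt (h : IsOstrowski α d n) (K : ℕ) :
    ostLow α d K < shiftDen α (K + 1) := by
  induction K using Nat.twoStepInduction with
  | zero => simp [ostLow, shiftDen, convDen]
  | one => simpa [ostLow, shiftDen, convDen] using h.digit_zero
  | more K h0 h1 =>
    rw [ostLow_succ, shiftDen_add_two α (K + 1)]
    rcases (h.digit_le_partQuot (K + 1)).lt_or_eq with hlt | heq
    · nlinarith
    · have hK : d K = 0 := h.digit_rule (K + 1) (by lia) heq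
      rw [heq, ostLow_succ, hK]
      linarith

theorem digit_eq_zero_of_lt (h : IsOstrowski α d n) (hα : Irrational α) {K : ℕ}
    (hn : n < shiftDen α (K + 1)) {k : ℕ} (hk : K ≤ k) : d k = 0 := by
  by_contra hd
  have hle := h.ostLow_le (k + 1)
  rw [ostLow_succ] at hle
  have hmono := monotone_shiftDen hα (Nat.succ_le_succ hk)
  have hmul := Nat.le_mul_of_pos_left (shiftDen α (k + 1)) (Nat.pos_of_ne_zero hd)
  lia

theorem lt_of_digit_eq_zero (h : IsOstrowski α d n) {K : ℕ}
    (hd : ∀ k, K ≤ k → d k = 0) : n < shiftDen α (K + 1) :=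
  (h.eq_ostLow hd).trans_lt (h.ostLow_lt K)

theorem digit_eq_zero_iff (h : IsOstrowski α d n) (K : ℕ) :
    d K = 0 ↔ ostLow α d (K + 1) < shiftDen α (K + 1) := by
  rw [ostLow_succ]
  refine ⟨fun hd => ?_, fun hlt => ?_⟩
  · rw [hd, zero_mul, add_zero]
    exact h.ostLow_lt K
  · by_contra hd
    have hmul := Nat.le_mul_of_pos_left (shiftDen α (K + 1)) (Nat.pos_of_ne_zero hd)
    lia

theorem ostTail_mem_Ioo (h : IsOstrowski α d n) (hα : Irrational α) (K : ℕ) :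
    ostTail α d K ∈ Set.Ioo (-convErr α (K + 1)) (convErr α K) := by
  obtain ⟨T, hKT, hT⟩ := exists_ge_forall_eq_zero d K
  induction hKT using Nat.decreasingInduction with
  | self =>
    rw [ostTail_eq_zero α hT]
    exact ⟨neg_lt_zero.2 (convErr_pos hα _), convErr_pos hα _⟩
  | of_succ K _ ih =>
    have hd : (d K : ℝ) ≤ partQuot α (K + 1) := by exact_mod_cast h.digit_le_partQuot K
    rw [ostTail_eq_sub, convErr_eq_mul_add hα K]
    constructor <;> nlinarith [ih.1, ih.2, convErr_pos hα (K + 1), (d K).cast_nonneg (α := ℝ)]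

theorem ostTail_lt (h : IsOstrowski α d n) (hα : Irrational α) {K : ℕ}
    (hd : d K < partQuot α (K + 1)) : ostTail α d K < convErr α K - convErr α (K + 1) := by
  have hd' : (d K : ℝ) + 1 ≤ partQuot α (K + 1) := by exact_mod_cast hd
  rw [ostTail_eq_sub, convErr_eq_mul_add hα K]
  nlinarith [(h.ostTail_mem_Ioo hα (K + 1)).1, convErr_pos hα (K + 1)]

theorem ostTail_pos (h : IsOstrowski α d n) (hα : Irrational α) {K : ℕ} (hd : d K ≠ 0) :
    0 < ostTail α d K := by
  have hd' : (1 : ℝ) ≤ d K := by exact_mod_cast Nat.one_le_iff_ne_zero.2 hd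
  rw [ostTail_eq_sub]
  nlinarith [(h.ostTail_mem_Ioo hα (K + 1)).2, convErr_pos hα (K + 1)]

theorem ostTail_pos_iff (h : IsOstrowski α d n) (hα : Irrational α) (K : ℕ) :
    0 < ostTail α d K ↔ EvenLead d K := by
  constructor
  · intro hpos
    have hex : ∃ i, d (K + i) ≠ 0 := by
      by_contra! hd
      refine hpos.ne' (ostTail_eq_zero α fun k hk => ?_)
      rw [← Nat.add_sub_cancel' hk]
      exact hd (k - K)
    have hzero : ∀ k, K ≤ k → k < K + Nat.find hex → d k = 0 := fun k hk hlt => by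
      rw [← Nat.add_sub_cancel' hk]
      exact not_not.1 (Nat.find_min hex (by lia))
    have hlead := Nat.find_spec hex
    rcases Nat.even_or_odd' (Nat.find hex) with ⟨t, ht | ht⟩
    · exact ⟨t, ht ▸ hzero, ht ▸ hlead⟩
    · rw [ostTail_eq_neg_one_pow_mul α hzero, Odd.neg_one_pow ⟨t, ht⟩] at hpos
      linarith [h.ostTail_pos hα hlead]
  · rintro ⟨t, hzero, hlead⟩
    rw [ostTail_eq_neg_one_pow_mul α hzero, Even.neg_one_pow (even_two_mul t), one_mul]
    exact h.ostTail_pos hα hlead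

theorem exists_neg_one_pow_mul_sub_eq (h : IsOstrowski α d n) (hα : Irrational α) (K : ℕ) :
    ∃ l : ℤ, n * ((-1) ^ K * α) - l = ostLow α d K * ((-1) ^ K * α) + ostTail α d K := by
  have hlow : ∀ L, ostLow α d L * α - (∑ k ∈ Finset.range L, d k * shiftNum α (k + 1) : ℤ)
      = ∑ k ∈ Finset.range L, d k * ((-1) ^ k * convErr α (k + 1)) := fun L => by
    rw [ostLow]
    push_cast
    rw [Finset.sum_mul, ← Finset.sum_sub_distrib]
    refine Finset.sum_congr rfl fun k _ => ?_
    have herr := shiftDen_mul_sub_shiftNum hα (k + 1)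
    rw [pow_succ, pow_succ] at herr
    linear_combination d k * herr
  obtain ⟨T, -, hT⟩ := exists_ge_forall_eq_zero d K
  have hn := hlow T
  rw [← h.eq_ostLow hT] at hn
  refine ⟨(-1) ^ K * (∑ k ∈ Finset.range T, d k * shiftNum α (k + 1)
    - ∑ k ∈ Finset.range K, d k * shiftNum α (k + 1)), ?_⟩
  rw [ostTail, finsuppSum_eq_sum_range (by simp) hT, ← hn, ← hlow K]
  push_cast
  ring

end IsOstrowski

theorem IsOstrowski.update {α : ℝ} (hα : Irrational α) {d : ℕ →₀ ℕ} {r c K : ℕ}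
    (h : IsOstrowski α d r) (hd : ∀ k, K < k → d k = 0) (hc : c ≤ partQuot α (K + 2))
    (hrule : c = partQuot α (K + 2) → d K = 0) :
    IsOstrowski α (d.update (K + 1) c) (r + c * shiftDen α (K + 2)) where
  sum_eq := by
    have hupdate : ∀ k, K + 2 ≤ k → d.update (K + 1) c k = 0 := fun k hk => by
      rw [Finsupp.update_apply, if_neg (by lia)]
      exact hd k (by lia)
    rw [finsuppSum_eq_sum_range (by simp) hupdate, Finset.sum_range_succ, Finsupp.update_apply,
      if_pos rfl, h.eq_ostLow hd, ostLow]
    refine congrArg₂ _ (Finset.sum_congr rfl fun k hk => ?_) rfl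
    rw [Finsupp.update_apply, if_neg (Finset.mem_range.1 hk).ne]
    rfl
  digit_zero := by
    rw [Finsupp.update_apply, if_neg (by lia)]
    exact h.digit_zero
  digit_le k hk := by
    rw [Finsupp.update_apply]
    split_ifs with hkK
    · rwa [hkK]
    · exact h.digit_le k hk
  digit_rule k hk := by
    have hpos := one_le_partQuot_succ hα k
    simp only [Finsupp.update_apply]
    split_ifs with hkK hkK' hkK'
    · lia
    · subst hkK
      exact hrule
    · rw [hd k (by lia)]
      lia
    · exact h.digit_rule k hk

theorem isOstrowski_single {α : ℝ} (hα : Irrational α) {n : ℕ} (hn : n < partQuot α 1) :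
    IsOstrowski α (Finsupp.single 0 n) n where
  sum_eq := by simp [convDen]
  digit_zero := by simpa using hn
  digit_le k hk := by simp [Nat.ne_of_lt hk]
  digit_rule k hk hd := by
    have hpos := one_le_partQuot_succ hα k
    rw [Finsupp.single_eq_of_ne (by lia)] at hd
    lia

theorem exists_isOstrowski_of_lt {α : ℝ} (hα : Irrational α) {n K : ℕ}
    (hn : n < shiftDen α (K + 1)) : ∃ d : ℕ →₀ ℕ, IsOstrowski α d n := by
  induction K using Nat.twoStepInduction generalizing n with
  | zero =>
    have hn1 : n < 1 := hn
    exact ⟨_, isOstrowski_single hα (hn1.trans_le (one_le_partQuot_succ hα 0))⟩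
  | one => exact ⟨_, isOstrowski_single hα hn⟩
  | more K h0 h1 =>
    have hrec : n < partQuot α (K + 2) * shiftDen α (K + 2) + shiftDen α (K + 1) :=
      shiftDen_add_two α (K + 1) ▸ hn
    have hmono := monotone_shiftDen hα (K + 1).le_succ
    have hmod := Nat.mod_lt n (shiftDen_succ_pos hα (K + 1))
    have hdiv := Nat.mod_add_div' n (shiftDen α (K + 2))
    have hc : n / shiftDen α (K + 2) ≤ partQuot α (K + 2) := by
      refine Nat.lt_succ_iff.1 (Nat.div_lt_of_lt_mul ?_)
      rw [Nat.mul_succ]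
      lia
    rw [← hdiv]
    rcases hc.lt_or_eq with hlt | heq
    · obtain ⟨d, hd⟩ := h1 hmod
      exact ⟨_, hd.update hα (fun k hk => hd.digit_eq_zero_of_lt hα hmod hk) hc
        fun h => absurd h hlt.ne⟩
    · rw [heq] at hdiv
      have hr : n % shiftDen α (K + 2) < shiftDen α (K + 1) := by lia
      obtain ⟨d, hd⟩ := h0 hr
      exact ⟨_, hd.update hα (fun k hk => hd.digit_eq_zero_of_lt hα hr hk.le) hc
        fun _ => hd.digit_eq_zero_of_lt hα hr le_rfl⟩

theorem exists_isOstrowski {α : ℝ} (hα : Irrational α) (n : ℕ) :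
    ∃ d : ℕ →₀ ℕ, IsOstrowski α d n :=
  exists_isOstrowski_of_lt hα (lt_shiftDen_add_two hα n)

/-! ### Ostrowski digits and the position of `n α` on the circle -/

theorem irrational_neg_one_pow_mul {α : ℝ} (hα : Irrational α) (k : ℕ) :
    Irrational ((-1) ^ k * α) := by
  rcases neg_one_pow_eq_or ℝ k with h | h <;> rw [h]
  · rwa [one_mul]
  · rw [neg_one_mul]
    exact hα.neg

theorem exists_abs_neg_one_pow_mul_sub_lt_iff (α e : ℝ) (n k : ℕ) :
    (∃ l : ℤ, |n * ((-1) ^ k * α) - l| < e) ↔ ∃ l : ℤ, |n * α - l| < e := by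
  rcases neg_one_pow_eq_or ℝ k with h | h <;> rw [h]
  · rw [one_mul]
  · refine (Equiv.neg ℤ).exists_congr fun l => ?_
    have hneg : n * (-1 * α) - l = -(n * α - (-l : ℤ)) := by
      push_cast
      ring
    rw [hneg, abs_neg, Equiv.neg_apply]

theorem gapBasis_convergent_zero {α : ℝ} (hα : Irrational α) (K : ℕ) :
    GapBasis ((-1) ^ K * α) (shiftDen α (K + 1)) (shiftDen α K) ((-1) ^ K * shiftNum α (K + 1))
      ((-1) ^ K * shiftNum α K) (convErr α (K + 1)) (convErr α K) := by
  simpa using gapBasis_convergent hα K (one_le_partQuot_succ hα K)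

theorem eq_zero_of_intCast_mul_eq {α : ℝ} (hα : Irrational α) {k l : ℤ} (h : k * α = l) :
    k = 0 :=
  not_not.1 fun hk => (hα.intCast_mul hk).ne_int l h

theorem GapBasis.eq_upper_of_mem_Ioo {α δ ε : ℝ} {u v : ℕ} {p p' k l : ℤ}
    (H : GapBasis α u v p p' δ ε) (hα : Irrational α) (hv : 0 < v) (hvu : v ≤ u) (hk₀ : 0 < k)
    (hku : k < u) (h : k * α - l ∈ Set.Ioo (-(2 * ε)) (δ + ε)) : k = v ∧ k * α - l = -ε := by
  have hneg : k * α - l < 0 := by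
    by_contra! hge
    refine H.notMem_Ioo_sum (by lia) hku ⟨hge.lt_of_ne' fun hzero => ?_, h.2⟩
    exact hk₀.ne' (eq_zero_of_intCast_mul_eq hα (sub_eq_zero.1 hzero))
  have hval : ((k - v : ℤ) : ℝ) * α - (l - p' : ℤ) = k * α - l + ε := by
    push_cast
    linear_combination -H.upper
  have hzero : k * α - l + ε = 0 := by
    by_contra hne
    have hle := H.upper_le_abs (abs_lt.2 (by lia)) (hval ▸ hne)
    rw [hval] at hle
    exact hle.not_gt (abs_lt.2 ⟨by linarith [h.1], by linarith⟩)
  have hkv := eq_zero_of_intCast_mul_eq hα (sub_eq_zero.1 (hval.trans hzero))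
  exact ⟨by lia, by linarith⟩

namespace IsOstrowski

variable {α : ℝ} {d : ℕ →₀ ℕ} {n : ℕ}

theorem ostLow_ostTail_eq (h : IsOstrowski α d n) (hα : Irrational α) {N n₀ : ℕ} {l : ℤ} {z : ℝ}
    (hn : n * ((-1) ^ N * α) - l = n₀ * ((-1) ^ N * α) + z) (hn₀ : n₀ < shiftDen α (N + 1))
    (hz0 : 0 < z) (hz : z < convErr α N)
    (hz' : shiftDen α N ≤ n₀ → z < convErr α N - convErr α (N + 1)) :
    ostLow α d N = n₀ ∧ ostTail α d N = z := by
  have H := gapBasis_convergent_zero hα N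
  obtain ⟨l', hl'⟩ := h.exists_neg_one_pow_mul_sub_eq hα N
  obtain ⟨hτ₁, hτ₂⟩ := h.ostTail_mem_Ioo hα N
  have hlow := h.ostLow_lt N
  have hval : ((n₀ - ostLow α d N : ℤ) : ℝ) * ((-1) ^ N * α) - (l' - l : ℤ)
      = ostTail α d N - z := by
    push_cast
    linarith
  have hpos := convErr_pos hα (N + 1)
  have heq : ostTail α d N = z := by
    rcases lt_trichotomy (ostTail α d N) z with hlt | heq | hgt
    · have hval' : ((ostLow α d N - n₀ : ℤ) : ℝ) * ((-1) ^ N * α) - (l - l' : ℤ)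
          = z - ostTail α d N := by
        push_cast at hval ⊢
        linarith
      rcases H.cases_of_pos (hval' ▸ sub_pos.2 hlt) with hc | hc | hc | hc | hc
      · lia
      · lia
      · lia
      · linarith [hz' (by lia)]
      · linarith
    · exact heq
    · rcases H.cases_of_pos (hval ▸ sub_pos.2 hgt) with hc | hc | hc | hc | hc
      · lia
      · lia
      · lia
      · linarith
      · linarith
  have hzero := eq_zero_of_intCast_mul_eq (irrational_neg_one_pow_mul hα N)
    (sub_eq_zero.1 (hval.trans (sub_eq_zero.2 heq)))
  exact ⟨by lia, heq⟩

theorem ostLow_eq_of_abs_lt (h : IsOstrowski α d n) (hα : Irrational α) {K : ℕ} {l : ℤ}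
    (hl : |n * ((-1) ^ (K + 1) * α) - l| < convErr α (K + 1)) (hlow : 0 < ostLow α d (K + 1)) :
    ostLow α d (K + 1) = shiftDen α (K + 1) ∧ 0 < ostTail α d (K + 1) := by
  obtain ⟨l', hl'⟩ := h.exists_neg_one_pow_mul_sub_eq hα (K + 1)
  obtain ⟨hτ₁, hτ₂⟩ := h.ostTail_mem_Ioo hα (K + 1)
  obtain ⟨hl₁, hl₂⟩ := abs_lt.1 hl
  have hlt := h.ostLow_lt (K + 1)
  have hval : ((ostLow α d (K + 1) : ℤ) : ℝ) * ((-1) ^ (K + 1) * α) - (l - l' : ℤ)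
      = n * ((-1) ^ (K + 1) * α) - l - ostTail α d (K + 1) := by
    push_cast
    linarith
  obtain ⟨heq, hτ⟩ := (gapBasis_convergent_zero hα (K + 1)).eq_upper_of_mem_Ioo
    (irrational_neg_one_pow_mul hα (K + 1)) (shiftDen_succ_pos hα K)
    (monotone_shiftDen hα (K + 1).le_succ) (k := ostLow α d (K + 1)) (l := l - l')
    (by lia) (by lia) (by rw [hval]; constructor <;> linarith)
  rw [hval] at hτ
  exact ⟨by lia, by linarith⟩

theorem exists_abs_lt_iff (h : IsOstrowski α d n) (hα : Irrational α) (K : ℕ) :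
    (∃ l : ℤ, |n * α - l| < convErr α (K + 1)) ↔
      (∀ k ≤ K, d k = 0) ∨ (∀ k < K, d k = 0) ∧ d K = 1 ∧ EvenLead d (K + 1) := by
  rw [← exists_abs_neg_one_pow_mul_sub_lt_iff α _ n (K + 1), ← h.ostTail_pos_iff hα]
  simp only [← Nat.lt_succ_iff, ← ostLow_eq_zero_iff hα]
  have hrec := ostLow_succ α d K
  constructor
  · rintro ⟨l, hl⟩
    refine (ostLow α d (K + 1)).eq_zero_or_pos.imp_right fun hpos => ?_
    obtain ⟨heq, hτ⟩ := h.ostLow_eq_of_abs_lt hα hl hpos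
    have hlt := h.ostLow_lt K
    have hdK : d K = 1 := by
      rw [heq] at hrec
      nlinarith
    rw [heq, hdK] at hrec
    exact ⟨by lia, hdK, hτ⟩
  · obtain ⟨l, hl⟩ := h.exists_neg_one_pow_mul_sub_eq hα (K + 1)
    obtain ⟨hτ₁, hτ₂⟩ := h.ostTail_mem_Ioo hα (K + 1)
    have hlt := convErr_succ_lt hα (K + 1)
    rintro (hlow | ⟨hlow, hdK, hτ⟩)
    · rw [hlow] at hl
      push_cast at hl
      exact ⟨l, abs_lt.2 ⟨by linarith, by linarith⟩⟩
    · have hupper := (gapBasis_convergent_zero hα (K + 1)).upper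
      rw [hrec, hlow, hdK] at hl
      push_cast at hl hupper
      refine ⟨l + (-1) ^ (K + 1) * shiftNum α (K + 1), abs_lt.2 ?_⟩
      push_cast
      constructor <;> linarith

end IsOstrowski

/-! ### Balanced rectangles and Ostrowski digits -/

theorem phaseBalanced_of_exists_abs_lt {α : ℝ} (hα : Irrational α) {m n M : ℕ} (hm : 0 < m)
    (hmM : m ≤ shiftDen α (M + 2)) (h : ∃ l : ℤ, |n * α - l| < convErr α (M + 1)) :
    PhaseBalanced α m n := by
  obtain ⟨r, hr⟩ := Nat.exists_eq_add_of_le' (one_le_partQuot_succ hα M)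
  obtain ⟨l, hl⟩ := (exists_abs_neg_one_pow_mul_sub_lt_iff α _ n M).2 h
  rw [← phaseBalanced_neg_one_pow_mul α m n M]
  refine (gapBasis_convergent hα M (r := r) (by lia)).phaseBalanced_of_near
    (irrational_neg_one_pow_mul hα M) hm ?_ hl
  rw [shiftDen_add_two, hr] at hmM
  linarith

theorem exists_add_mul_lt_le {u v m a : ℕ} (hv : v ≤ u) (hm₁ : u < m) (hm₂ : m ≤ a * u + v) :
    ∃ r < a, v + r * u < m ∧ m ≤ u + (v + r * u) := by
  have hmod := Nat.mod_add_div' (m - v - 1) u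
  have hlt := Nat.mod_lt (m - v - 1) (by lia : 0 < u)
  refine ⟨(m - v - 1) / u, Nat.div_lt_of_lt_mul ?_, by lia, by lia⟩
  rw [mul_comm]
  lia

namespace IsOstrowski

variable {α : ℝ} {d : ℕ →₀ ℕ} {n M : ℕ}

theorem phaseBalanced_of_ostTail_lt (hd : IsOstrowski α d n) (hα : Irrational α) {r : ℕ}
    (hr : r < partQuot α (M + 1)) (hlead : EvenLead d (M + 1))
    (hlow : ostLow α d (M + 1) < shiftDen α (M + 1) + (shiftDen α M + r * shiftDen α (M + 1)))
    (hτ : shiftDen α (M + 1) ≤ ostLow α d (M + 1) →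
      ostTail α d (M + 1) < 2 * convErr α (M + 1) - (convErr α M - r * convErr α (M + 1))) :
    PhaseBalanced α (shiftDen α (M + 1) + (shiftDen α M + r * shiftDen α (M + 1))) n := by
  obtain ⟨l, hl⟩ := hd.exists_neg_one_pow_mul_sub_eq hα (M + 1)
  rw [← phaseBalanced_neg_one_pow_mul α _ n M]
  refine (gapBasis_convergent hα M hr).phaseBalanced_of_next (irrational_neg_one_pow_mul hα M)
    (l := -l) ?_ ((hd.ostTail_pos_iff hα _).2 hlead) (hd.ostTail_mem_Ioo hα _).2 hlow hτ
  rw [pow_succ] at hl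
  push_cast
  linear_combination -hl

theorem phaseBalanced_shiftDen_add_mul (hd : IsOstrowski α d n) (hα : Irrational α) {a : ℕ}
    (ha : 1 ≤ a) (haM : a ≤ partQuot α (M + 1)) (hdM : d M = 0) (hlead : EvenLead d (M + 1)) :
    PhaseBalanced α (shiftDen α M + a * shiftDen α (M + 1)) n := by
  obtain ⟨r, rfl⟩ := Nat.exists_eq_add_of_le' ha
  have hlow := (hd.digit_eq_zero_iff M).1 hdM
  have hm : shiftDen α M + (r + 1) * shiftDen α (M + 1)
      = shiftDen α (M + 1) + (shiftDen α M + r * shiftDen α (M + 1)) := by ring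
  rw [hm]
  exact hd.phaseBalanced_of_ostTail_lt hα haM hlead (by lia) fun hle => absurd hle hlow.not_ge

theorem phaseBalanced_shiftDen (hd : IsOstrowski α d n) (hα : Irrational α)
    (hlead : EvenLead d (M + 1)) : PhaseBalanced α (shiftDen α (M + 2)) n := by
  obtain ⟨r, hr⟩ := Nat.exists_eq_add_of_le' (one_le_partQuot_succ hα M)
  have hm : shiftDen α (M + 2)
      = shiftDen α (M + 1) + (shiftDen α M + r * shiftDen α (M + 1)) := by
    rw [shiftDen_add_two, hr]
    ring
  rw [hm]
  refine hd.phaseBalanced_of_ostTail_lt hα (by lia) hlead (hm ▸ hd.ostLow_lt _) fun hle => ?_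
  have hdM : d M ≠ 0 := fun h => ((hd.digit_eq_zero_iff M).1 h).not_ge hle
  have hlt : d (M + 1) < partQuot α (M + 2) := (hd.digit_le_partQuot _).lt_of_ne fun h =>
    hdM (hd.digit_rule (M + 1) (by lia) h)
  have herr := convErr_eq_mul_add hα M
  rw [hr] at herr
  push_cast at herr
  linarith [hd.ostTail_lt hα hlt]

theorem evenLead_of_next (hd : IsOstrowski α d n) (hα : Irrational α) {r n₀ : ℕ} {l : ℤ}
    {z : ℝ} (hr : r < partQuot α (M + 1))
    (hn : n * ((-1) ^ M * α) - l = n₀ * ((-1) ^ M * α) - z)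
    (hn₀ : n₀ < shiftDen α (M + 1) + (shiftDen α M + r * shiftDen α (M + 1))) (hz0 : 0 < z)
    (hz : z < convErr α (M + 1)) (hz' : shiftDen α (M + 1) ≤ n₀ →
      z < 2 * convErr α (M + 1) - (convErr α M - r * convErr α (M + 1))) :
    EvenLead d (M + 1) ∧ (r + 1 = partQuot α (M + 1) ∨
      r + 1 < partQuot α (M + 1) ∧ n₀ < shiftDen α (M + 1) ∧ ostLow α d (M + 1) = n₀) := by
  have hrec := shiftDen_add_two α M
  have herr := convErr_eq_mul_add hα M
  have hpos' := convErr_pos hα (M + 2)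
  have hr' : (r : ℝ) + 1 ≤ partQuot α (M + 1) := by exact_mod_cast hr
  have hn' : n * ((-1) ^ (M + 1) * α) - (-l : ℤ) = n₀ * ((-1) ^ (M + 1) * α) + z := by
    rw [pow_succ]
    push_cast
    linear_combination -hn
  have hlt : n₀ < shiftDen α (M + 2) := by nlinarith
  obtain ⟨hlow, hτ⟩ := hd.ostLow_ostTail_eq hα hn' hlt hz0 hz fun hle => by
    nlinarith [hz' hle]
  refine ⟨(hd.ostTail_pos_iff hα _).1 (hτ ▸ hz0), (Nat.eq_or_lt_of_le hr).imp_right fun hr₂ => ?_⟩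
  have hr₂' : (r : ℝ) + 2 ≤ partQuot α (M + 1) := by exact_mod_cast hr₂
  exact ⟨hr₂, not_le.1 fun hle => by nlinarith [hz' hle], hlow⟩

theorem near_or_evenLead_of_phaseBalanced (hd : IsOstrowski α d n) (hα : Irrational α) {m : ℕ}
    (hm₁ : shiftDen α (M + 1) < m) (hm₂ : m ≤ shiftDen α (M + 2)) (hmn : m ≤ n)
    (hb : PhaseBalanced α m n) :
    (∃ l : ℤ, |n * α - l| < convErr α (M + 1)) ∨ EvenLead d (M + 1) ∧
      (m = shiftDen α (M + 2) ∨ 1 ≤ M ∧ d M = 0 ∧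
        ∃ a, 1 ≤ a ∧ a < partQuot α (M + 1) ∧ m = shiftDen α M + a * shiftDen α (M + 1)) := by
  have hmono := monotone_shiftDen hα M.le_succ
  have hrec := shiftDen_add_two α M
  obtain ⟨r, hr, hr₁, hr₂⟩ := exists_add_mul_lt_le hmono hm₁ (hrec ▸ hm₂)
  rw [← exists_abs_neg_one_pow_mul_sub_lt_iff α _ n M]
  refine ((gapBasis_convergent hα M hr).near_or_next_of_phaseBalanced
    (irrational_neg_one_pow_mul hα M) (shiftDen_succ_pos hα M) hm₁ (by lia) hr₁ hr₂ hmn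
    ((phaseBalanced_neg_one_pow_mul α m n M).2 hb)).elim .inl ?_
  rintro ⟨hm, n₀, hn₀, l, z, hn, hz0, hz, hz'⟩
  obtain ⟨hlead, hcase⟩ := hd.evenLead_of_next hα hr hn (hm ▸ hn₀) hz0 hz hz'
  rcases hcase with hra | ⟨hra, hn₀M, hlow⟩
  · exact .inr ⟨hlead, .inl (by rw [hm, hrec, ← hra]; ring)⟩
  rcases M.eq_zero_or_pos with rfl | hM
  · have hn₀0 : n₀ = 0 := Nat.lt_one_iff.1 hn₀M
    rw [hn₀0, Nat.cast_zero] at hn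
    exact .inl ⟨l, abs_lt.2 ⟨by linarith, by linarith⟩⟩
  · exact .inr ⟨hlead, .inr ⟨hM, (hd.digit_eq_zero_iff M).2 (hlow ▸ hn₀M), r + 1, by lia, hra,
      by rw [hm]; ring⟩⟩

end IsOstrowski

theorem digits_of_exists_abs_lt {α : ℝ} (hα : Irrational α) {m n M : ℕ} {b d : ℕ →₀ ℕ}
    (hb : IsOstrowski α b m) (hd : IsOstrowski α d n) (hm₁ : shiftDen α (M + 1) < m)
    (hm₂ : m ≤ shiftDen α (M + 2)) (h : ∃ l : ℤ, |n * α - l| < convErr α (M + 1)) :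
    (∃ K, (∀ k, K < k → b k = 0) ∧ ∀ k ≤ K, d k = 0) ∨
      (∃ K, (∀ k, K < k → b k = 0) ∧ b K ≠ 0 ∧
        (∀ k < K, d k = 0) ∧ d K = 1 ∧ EvenLead d (K + 1)) ∨
      m = shiftDen α (M + 2) ∧ EvenLead d (M + 1) := by
  have hnear := (hd.exists_abs_lt_iff hα M).1 h
  rcases hm₂.lt_or_eq with hlt | heq
  · have hb0 : ∀ k, M < k → b k = 0 := fun k hk => hb.digit_eq_zero_of_lt hα hlt hk
    have hbM : b M ≠ 0 := fun hbM => by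
      rw [hb.digit_eq_zero_iff M, ← hb.eq_ostLow hb0] at hbM
      exact hbM.not_gt hm₁
    exact hnear.imp (⟨M, hb0, ·⟩) fun hd0 => .inl ⟨M, hb0, hbM, hd0⟩
  rcases hnear with hd0 | ⟨-, -, hlead⟩
  · by_cases hdM : d (M + 1) = 0
    · have hlt : m < shiftDen α (M + 3) := by
        have hle := shiftDen_add_le hα (M + 1)
        have hpos := shiftDen_succ_pos hα M
        lia
      refine .inl ⟨M + 1, fun k hk => hb.digit_eq_zero_of_lt hα hlt hk, fun k hk => ?_⟩
      rcases hk.lt_or_eq with hk | rfl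
      · exact hd0 k (Nat.lt_succ_iff.1 hk)
      · exact hdM
    · exact .inr (.inr ⟨heq, 0, by lia, hdM⟩)
  · exact .inr (.inr ⟨heq, hlead⟩)

theorem theorem2p1_general {α : ℝ} (hα : Irrational α) (θ : ℝ) {m n : ℕ} (hm : 2 ≤ m)
    (hmn : m ≤ n) {b d : ℕ →₀ ℕ} (hb : IsOstrowski α b m) (hd : IsOstrowski α d n) :
    BalancedRectangles (sturmianWord α θ) m n ↔
      ((∃ M : ℕ, (∀ k, M < k → b k = 0) ∧ (∀ k, k ≤ M → d k = 0)) ∨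
        (∃ M t : ℕ, (∀ k, M < k → b k = 0) ∧ b M ≠ 0 ∧
          (∀ k, k < M → d k = 0) ∧ d M = 1 ∧
          (∀ k, M < k → k < M + 1 + 2 * t → d k = 0) ∧ d (M + 1 + 2 * t) ≠ 0) ∨
        (∃ M t : ℕ, m = convDen α M ∧
          (∀ k, M ≤ k → k < M + 2 * t → d k = 0) ∧ d (M + 2 * t) ≠ 0) ∨
        (∃ M a t : ℕ, 1 ≤ M ∧ 1 ≤ a ∧ a < partQuot α (M + 1) ∧
          m = convDen α (M - 1) + a * convDen α M ∧
          (∀ k, M ≤ k → k < M + 1 + 2 * t → d k = 0) ∧ d (M + 1 + 2 * t) ≠ 0)) := by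
  rw [balancedRectangles_iff_phaseBalanced hα]
  constructor
  · intro hbal
    obtain ⟨M, hm₁, hm₂⟩ := exists_shiftDen_lt_le hα hm
    rcases hd.near_or_evenLead_of_phaseBalanced hα hm₁ hm₂ hmn hbal with
      hnear | ⟨⟨t, hd0, hlead⟩, heq | ⟨hM, hdM, a, ha, haM, heq⟩⟩
    · rcases digits_of_exists_abs_lt hα hb hd hm₁ hm₂ hnear with
        h | ⟨K, hb0, hbK, hd0, hdK, t, hlead⟩ | ⟨heq, t, hlead⟩
      · exact .inl h
      · exact .inr (.inl ⟨K, t, hb0, hbK, hd0, hdK, hlead⟩)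
      · exact .inr (.inr (.inl ⟨M + 1, t, heq, hlead⟩))
    · exact .inr (.inr (.inl ⟨M + 1, t, heq, hd0, hlead⟩))
    · obtain ⟨M, rfl⟩ := Nat.exists_eq_add_of_le' hM
      exact .inr (.inr (.inr ⟨M + 1, a, t, hM, ha, haM, heq,
        fun k hk hkt => hk.eq_or_lt.elim (· ▸ hdM) (hd0 k · hkt), hlead⟩))
  · have hnear : ∀ M, (∀ k, M < k → b k = 0) →
        (∃ l : ℤ, |n * α - l| < convErr α (M + 1)) → PhaseBalanced α m n := fun M hb0 =>
      phaseBalanced_of_exists_abs_lt hα (by lia) (hb.lt_of_digit_eq_zero hb0).le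
    rintro (⟨M, hb0, hd0⟩ | ⟨M, t, hb0, -, hd0, hdM, hlead⟩ | ⟨M, t, rfl, hlead⟩ |
      ⟨M, a, t, hM, ha, haM, rfl, hd0, hlead⟩)
    · exact hnear M hb0 ((hd.exists_abs_lt_iff hα M).2 (.inl hd0))
    · exact hnear M hb0 ((hd.exists_abs_lt_iff hα M).2 (.inr ⟨hd0, hdM, t, hlead⟩))
    · cases M with
      | zero => exact absurd hm (Nat.not_succ_le_self 1)
      | succ M => exact hd.phaseBalanced_shiftDen hα ⟨t, hlead⟩
    · obtain ⟨M, rfl⟩ := Nat.exists_eq_add_of_le' hM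
      exact hd.phaseBalanced_shiftDen_add_mul hα ha haM.le (hd0 _ le_rfl (by lia))
        ⟨t, fun k hk => hd0 k (by lia), hlead⟩

theorem theorem2p1 (α : ℝ) (hα : Irrational α) (hα01 : α ∈ Set.Ioo (0 : ℝ) 1)
    (θ : ℝ) (hθ : θ ∈ Set.Ico (0 : ℝ) 1) (m n : ℕ) (hm : 2 ≤ m) (hmn : m ≤ n) :
    BalancedRectangles (sturmianWord α θ) m n ↔
      ∃ b d : ℕ →₀ ℕ, IsOstrowski α b m ∧ IsOstrowski α d n ∧
        ((∃ M : ℕ, (∀ k, M < k → b k = 0) ∧ (∀ k, k ≤ M → d k = 0)) ∨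
          (∃ M t : ℕ, (∀ k, M < k → b k = 0) ∧ b M ≠ 0 ∧
            (∀ k, k < M → d k = 0) ∧ d M = 1 ∧
            (∀ k, M < k → k < M + 1 + 2 * t → d k = 0) ∧ d (M + 1 + 2 * t) ≠ 0) ∨
          (∃ M t : ℕ, m = convDen α M ∧
            (∀ k, M ≤ k → k < M + 2 * t → d k = 0) ∧ d (M + 2 * t) ≠ 0) ∨
          (∃ M a t : ℕ, 1 ≤ M ∧ 1 ≤ a ∧ a < partQuot α (M + 1) ∧
            m = convDen α (M - 1) + a * convDen α M ∧
            (∀ k, M ≤ k → k < M + 1 + 2 * t → d k = 0) ∧ d (M + 1 + 2 * t) ≠ 0)) := by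
  refine ⟨fun h => ?_, fun ⟨b, d, hb, hd, h⟩ => (theorem2p1_general hα θ hm hmn hb hd).2 h⟩
  obtain ⟨⟨b, hb⟩, d, hd⟩ := And.intro (exists_isOstrowski hα m) (exists_isOstrowski hα n)
  exact ⟨b, d, hb, hd, (theorem2p1_general hα θ hm hmn hb hd).1 h⟩
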